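/- Let $m\ge 6$ be an integer. Let $\varepsilon_1,\dots,\varepsilon_m$ be the diagonal characters of the maximal torus of $\mathrm{SL}_m(\mathbb C)$, $\alpha_{i,j}=\varepsilon_i-\varepsilon_j$ its roots, $\Phi^+=\{\alpha_{i,j}:1\le i<j\le m\}$, $\kappa$ the Cartan–Killing form, and let $\theta$ be the involution of type $\mathrm{AIII}(2,m)$, which acts on characters by exchanging the indices $1\leftrightarrow m$ and $2\leftrightarrow m-1$ and fixing the others; let $\Phi^\theta$ be the set of roots fixed by $\theta$. Identify $(x,y)\in\mathbb R^2$ with $p=x\,\alpha_{1,m}+y\,\alpha_{2,m-1}$. Let $\Delta_m^{B\ell}\subset\mathbb R^2$ be the convex hull of the five points $$(0,0),\quad (m,0),\quad (m,m-4),\quad (m-1,m-2),\quad \left(m-\tfrac32,\,m-\tfrac32\right);$$ this is the moment polytope of the anticanonical line bundle of the blow-up $B\ell_Z(X_m)$ of the wonderful compactification $X_m$ of the symmetric space $\mathrm{SL}_m(\mathbb C)/S(\mathrm{GL}_2(\mathbb C)\times \mathrm{GL}_{m-2}(\mathbb C))$ along its unique closed orbit $Z$. Let $$P(x,y)=\prod_{\alpha\in\Phi^+\setminus\Phi^\theta}\kappa(\alpha,p)$$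 be the density of the Duistermaat–Heckman measure (up to a positive constant, $P(x,y)=4x^{2m-7}y^{2m-7}(x+y)^2(x-y)^2$). Then $V=\int_{\Delta_m^{B\ell}}P\,dx\,dy>0$, and the barycenter $$(\bar x,\bar y)=\frac1V\left(\int_{\Delta_m^{B\ell}}x\,P(x,y)\,dx\,dy,\ \int_{\Delta_m^{B\ell}}y\,P(x,y)\,dx\,dy\right)$$ of $\Delta_m^{B\ell}$ with respect to the Duistermaat–Heckman measure satisfies $$\bar x+\bar y<2m-4 .$$ -/

import Mathlib

/-! The symmetric space of type AIII(2, m) is `SL_m / S(GL_2 × GL_{m-2})`. Weights of the diagonal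
maximal torus of `SL_m` are written as vectors `u : ℕ → ℝ` whose entries are read at the
indices `1, …, m`; all the weights below vanish at the other indices. -/

namespace AIIITwo

/-- The root `α_{i,j} = ε_i - ε_j`. -/
noncomputable def root (i j : ℕ) : ℕ → ℝ := Pi.single i 1 - Pi.single j 1

/-- The permutation of the indices induced by the involution
`diag(a_1, a_2, a_3, …, a_{m-2}, a_{m-1}, a_m) ↦ diag(a_m, a_{m-1}, a_3, …, a_{m-2}, a_2, a_1)`:
it exchanges `1 ↔ m` and `2 ↔ m - 1` and fixes the other indices. -/
def thetaIdx (m k : ℕ) : ℕ :=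
  if k = 1 then m else if k = 2 then m - 1 else if k = m - 1 then 2 else if k = m then 1 else k

/-- The involution `θ` on weights. -/
def theta (m : ℕ) (u : ℕ → ℝ) : ℕ → ℝ := fun k => u (thetaIdx m k)

open Classical in
/-- The index pairs `(i, j)`, `1 ≤ i < j ≤ m`, of the roots `α_{i,j}` in `Φ⁺ \ Φ^θ`, that is,
of the positive roots of `SL_m` that are not fixed by `θ`. -/
noncomputable def movedPosRoots (m : ℕ) : Finset (ℕ × ℕ) :=
  (Finset.Icc 1 m ×ˢ Finset.Icc 1 m).filter
    (fun a => a.1 < a.2 ∧ theta m (root a.1 a.2) ≠ root a.1 a.2)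

/-- The Cartan–Killing form of `sl_m` on weights. On the diagonal Cartan subalgebra the Killing
form is `2 m · tr(X Y)`, so on weights (of entry sum zero) it is `(2 m)⁻¹` times the dot product. -/
noncomputable def killing (m : ℕ) (u v : ℕ → ℝ) : ℝ :=
  (2 * (m : ℝ))⁻¹ * ∑ k ∈ Finset.Icc 1 m, u k * v k

/-- The point `x α_{1,m} + y α_{2,m-1}` of `M ⊗ ℝ` with coordinates `p = (x, y)`. -/
noncomputable def weight (m : ℕ) (p : ℝ × ℝ) : ℕ → ℝ :=
  p.1 • root 1 m + p.2 • root 2 (m - 1)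

/-- The density `∏_{α ∈ Φ⁺ \ Φ^θ} κ(α, p)` of the Duistermaat–Heckman measure with respect to
Lebesgue measure `dp = dx dy`. -/
noncomputable def dhDensity (m : ℕ) (p : ℝ × ℝ) : ℝ :=
  ∏ a ∈ movedPosRoots m, killing m (root a.1 a.2) (weight m p)

/-- The Duistermaat–Heckman volume of a region. -/
noncomputable def dhVolume (m : ℕ) (S : Set (ℝ × ℝ)) : ℝ := ∫ p in S, dhDensity m p

/-- The barycenter of a region with respect to the Duistermaat–Heckman measure. -/
noncomputable def dhBarycenter (m : ℕ) (S : Set (ℝ × ℝ)) : ℝ × ℝ :=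
  ((∫ p in S, p.1 * dhDensity m p) / dhVolume m S,
    (∫ p in S, p.2 * dhDensity m p) / dhVolume m S)

/-- The moment polytope of the anticanonical bundle of the blow-up of the wonderful
compactification of type AIII(2, m) along its closed orbit, in the coordinates `(x, y)`. -/
def blowupPolytope (m : ℕ) : Set (ℝ × ℝ) :=
  convexHull ℝ {((0 : ℝ), (0 : ℝ)), ((m : ℝ), (0 : ℝ)), ((m : ℝ), (m : ℝ) - 4),
    ((m : ℝ) - 1, (m : ℝ) - 2), ((m : ℝ) - 3 / 2, (m : ℝ) - 3 / 2)}

end AIIITwo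

/-!
Put `c = 2 m - 4` and `n = 2 m - 7 = c - 3`. Up to a positive constant the density is
`x ^ n * y ^ n * (x + y) ^ 2 * (x - y) ^ 2` (`exists_dhDensity_eq`), and the claim is that
`x + y - c` has negative integral against it over the polytope.

The polytope is star-shaped about the origin and the density is homogeneous, so the integral is
computed along rays. In the coordinates `x = ρ (c + w) / 2`, `y = ρ (c - w) / 2`, with `0 ≤ w ≤ c`
and `0 < ρ ≤ R w`, the inner integral is elementary (`integral_sectorRegion`,
`polyDensity_ray`), and what remains is
`∫ w in 0..c, W w * (2 c R w - (2 c + 1)) < 0` with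
`W w = w ^ 2 * (c ^ 2 - w ^ 2) ^ n * (R w) ^ (2 n + 6)`.

This inequality is proved for all `m` at once with a barrier: if
`B' + B * W' / W ≥ 2 c R - (2 c + 1)` on an interval, then `W * B` increases at least as much as
the integral over that interval (`integral_rayWeight_le`). As `c → ∞` the weight `W` has a limit
after normalization, with `w` of order one, so that one barrier, independent of `c` on each
interval except for one breakpoint, can serve all `c ≥ 8`: it is `7 w / 20` for
`w ≤ c / (c + 1)`, followed by three quadratics in `w`. Their supersolution inequalities become
polynomial inequalities in `c - 8 ≥ 0` and `w` (`barrier_poly_nonneg_left` and the two after it).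
-/

open Set MeasureTheory

namespace AIIITwo

/-! ### Barriers for integrals against `rayWeight` -/

/-- The product rule in logarithmic form: `l` and `k` are the logarithmic derivatives, so no factor
has to be nonzero. -/
theorem hasDerivAt_mul_of_logDeriv {f g : ℝ → ℝ} {l k x : ℝ} (hf : HasDerivAt f (f x * l) x)
    (hg : HasDerivAt g (g x * k) x) :
    HasDerivAt (fun t => f t * g t) (f x * g x * (l + k)) x := by
  convert! hf.mul hg using 1
  ring

theorem hasDerivAt_pow_of_logDeriv {f : ℝ → ℝ} {l x : ℝ} (hf : HasDerivAt f (f x * l) x)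
    (N : ℕ) : HasDerivAt (fun t => f t ^ N) (f x ^ N * (N * l)) x := by
  cases N with
  | zero => simpa using! hasDerivAt_const x (1 : ℝ)
  | succ N =>
    convert! hf.pow (N + 1) using 1
    push_cast
    ring

/-- The weight in the variable `w` that labels the rays from the origin, up to a constant, after
the integration along the ray, from the origin to its end at the parameter `r`. -/
noncomputable def rayWeight (n : ℕ) (c w r : ℝ) : ℝ := w ^ 2 * (c ^ 2 - w ^ 2) ^ n * r ^ (2 * n + 6)

theorem hasDerivAt_rayWeight (n : ℕ) {c a b k w : ℝ} (hw : 0 < w) (hwc : w < c)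
    (hb : b + k * w ≠ 0) :
    HasDerivAt (fun t => rayWeight n c t (a / (b + k * t)))
      (rayWeight n c w (a / (b + k * w)) *
        (2 / w - n * (2 * w) / (c ^ 2 - w ^ 2) - (2 * n + 6) * k / (b + k * w))) w := by
  have hD : c ^ 2 - w ^ 2 ≠ 0 := by nlinarith
  have h1 : HasDerivAt (fun t : ℝ => t) (w * (1 / w)) w := by
    rw [mul_one_div_cancel hw.ne']; exact hasDerivAt_id w
  have h2 : HasDerivAt (fun t : ℝ => c ^ 2 - t ^ 2)
      ((c ^ 2 - w ^ 2) * (-(2 * w) / (c ^ 2 - w ^ 2))) w := by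
    rw [mul_div_cancel₀ _ hD]
    simpa using! ((hasDerivAt_id w).pow 2).const_sub (c ^ 2)
  have h3 : HasDerivAt (fun t : ℝ => a / (b + k * t))
      (a / (b + k * w) * (-k / (b + k * w))) w := by
    have := (hasDerivAt_const w a).div (((hasDerivAt_id w).const_mul k).const_add b) hb
    convert! this using 1
    simp only [id]
    field_simp
    ring
  have := hasDerivAt_mul_of_logDeriv (hasDerivAt_mul_of_logDeriv
    (hasDerivAt_pow_of_logDeriv h1 2) (hasDerivAt_pow_of_logDeriv h2 n))
    (hasDerivAt_pow_of_logDeriv h3 (2 * n + 6))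
  refine this.congr_deriv ?_
  unfold rayWeight
  push_cast
  ring

/-- Comparison with a barrier: if `B` is a supersolution of the linear equation satisfied by
`(rayWeight)⁻¹ * ∫ ...`, then `rayWeight * B` grows at least as fast as the integral. -/
theorem integral_rayWeight_le (n : ℕ) {c a b k p q : ℝ} {B B' : ℝ → ℝ} (hp : 0 ≤ p)
    (hpq : p ≤ q) (hq : q ≤ c) (ha : 0 ≤ a) (hb : ∀ w ∈ Icc p q, 0 < b + k * w)
    (hB : ∀ w, HasDerivAt B (B' w) w)
    (h : ∀ w ∈ Ioo p q, 2 * c * (a / (b + k * w)) - (2 * c + 1) ≤ B' w + B w *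
      (2 / w - n * (2 * w) / (c ^ 2 - w ^ 2) - (2 * n + 6) * k / (b + k * w))) :
    ∫ w in p..q, rayWeight n c w (a / (b + k * w)) *
        (2 * c * (a / (b + k * w)) - (2 * c + 1)) ≤
      rayWeight n c q (a / (b + k * q)) * B q - rayWeight n c p (a / (b + k * p)) * B p := by
  have hr : ContinuousOn (fun w => a / (b + k * w)) (Icc p q) :=
    continuousOn_const.div (by fun_prop) fun w hw => (hb w hw).ne'
  have hW : ContinuousOn (fun w => rayWeight n c w (a / (b + k * w))) (Icc p q) := by
    unfold rayWeight
    exact ContinuousOn.mul (by fun_prop) (hr.pow _)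
  have hBc : Continuous B := continuous_iff_continuousAt.2 fun w => (hB w).continuousAt
  refine intervalIntegral.integral_le_sub_of_hasDeriv_right_of_le
    (g := fun w => rayWeight n c w (a / (b + k * w)) * B w)
    (g' := fun w => rayWeight n c w (a / (b + k * w)) *
        (2 / w - n * (2 * w) / (c ^ 2 - w ^ 2) - (2 * n + 6) * k / (b + k * w)) * B w +
        rayWeight n c w (a / (b + k * w)) * B' w) hpq
    (hW.mul hBc.continuousOn) (fun w hw => ?_) ?_ fun w hw => ?_
  · exact ((hasDerivAt_rayWeight n (hp.trans_lt hw.1) (hw.2.trans_le hq)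
      (hb w (Ioo_subset_Icc_self hw)).ne').mul (hB w)).hasDerivWithinAt
  · exact (hW.mul ((continuousOn_const.mul hr).sub continuousOn_const)).integrableOn_Icc
  · have hw0 : 0 < w := hp.trans_lt hw.1
    have hpos : 0 ≤ rayWeight n c w (a / (b + k * w)) := by
      have : 0 ≤ c ^ 2 - w ^ 2 := by nlinarith [hw.2.trans_le hq]
      have := hb w (Ioo_subset_Icc_self hw)
      unfold rayWeight
      positivity
    have := mul_le_mul_of_nonneg_left (h w hw) hpos
    linarith

/-! ### Positivity certificates for the barrier -/

/-- The supersolution inequality of `integral_rayWeight_le` follows from its form with the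
denominators `w`, `c ^ 2 - w ^ 2` and `b + k * w` cleared. -/
theorem le_of_cleared {N c a b k w β β' : ℝ} (hw : 0 < w) (hD : 0 < c ^ 2 - w ^ 2)
    (hE : 0 < b + k * w)
    (h : 0 ≤ β' * w * (c ^ 2 - w ^ 2) * (b + k * w) + β *
      (2 * (c ^ 2 - w ^ 2) * (b + k * w) - 2 * N * w ^ 2 * (b + k * w)
        - (2 * N + 6) * k * w * (c ^ 2 - w ^ 2)) -
      w * (c ^ 2 - w ^ 2) * (2 * c * a - (2 * c + 1) * (b + k * w))) :
    2 * c * (a / (b + k * w)) - (2 * c + 1) ≤ β' + β *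
      (2 / w - N * (2 * w) / (c ^ 2 - w ^ 2) - (2 * N + 6) * k / (b + k * w)) := by
  have := div_nonneg h (mul_pos (mul_pos hw hD) hE).le
  rw [← sub_nonneg]
  convert! this using 1
  clear this h
  generalize c ^ 2 - w ^ 2 = D at *
  generalize b + k * w = E at *
  field_simp

/-- The cleared supersolution inequality for the first quadratic piece of the barrier. With
`c = 8 + e`, each coefficient of a power of `e` is a polynomial of degree at most `5` in `w` whose
Bernstein coefficients on the interval are nonnegative. -/
theorem barrier_poly_nonneg_left {c w : ℝ} (hc : 8 ≤ c) (hw : w ∈ Icc (8 / 9 : ℝ) (8 / 5)) :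
    0 ≤ (183 / 200 - 19 / 50 * w) * w * (c ^ 2 - w ^ 2) * (3 * c + 1 * w) +
      (-69 / 200 + 183 / 200 * w - 19 / 100 * w ^ 2) *
      (2 * (c ^ 2 - w ^ 2) * (3 * c + 1 * w) - 2 * (c - 3) * w ^ 2 * (3 * c + 1 * w)
        - 2 * c * 1 * w * (c ^ 2 - w ^ 2)) -
      w * (c ^ 2 - w ^ 2) * (2 * c * (3 * c + 4) - (2 * c + 1) * (3 * c + 1 * w)) := by
  obtain ⟨e, rfl⟩ : ∃ e, c = 8 + e := ⟨c - 8, by ring⟩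
  have h (i j l : ℕ) : 0 ≤ e ^ i * (w - 8 / 9) ^ j * (8 / 5 - w) ^ l :=
    mul_nonneg (mul_nonneg (pow_nonneg (by linarith) i) (pow_nonneg (sub_nonneg.2 hw.1) j))
      (pow_nonneg (sub_nonneg.2 hw.2) l)
  linarith [h 0 0 5, h 0 1 4, h 0 2 3, h 0 3 2, h 0 4 1, h 0 5 0,
    h 1 0 5, h 1 1 4, h 1 2 3, h 1 3 2, h 1 4 1, h 1 5 0,
    h 2 0 5, h 2 1 4, h 2 2 3, h 2 3 2, h 2 4 1, h 2 5 0,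
    h 3 0 5, h 3 1 4, h 3 2 3, h 3 3 2, h 3 4 1, h 3 5 0]

/-- The analogue of `barrier_poly_nonneg_left` for the second quadratic piece. -/
theorem barrier_poly_nonneg_right {c w : ℝ} (hc : 8 ≤ c) (hw : w ∈ Icc (8 / 5 : ℝ) (4)) :
    0 ≤ (31 / 50 - 1 / 5 * w) * w * (c ^ 2 - w ^ 2) * (3 * c + 1 * w) +
      (-1 / 10 + 31 / 50 * w - 1 / 10 * w ^ 2) *
      (2 * (c ^ 2 - w ^ 2) * (3 * c + 1 * w) - 2 * (c - 3) * w ^ 2 * (3 * c + 1 * w)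
        - 2 * c * 1 * w * (c ^ 2 - w ^ 2)) -
      w * (c ^ 2 - w ^ 2) * (2 * c * (3 * c + 4) - (2 * c + 1) * (3 * c + 1 * w)) := by
  obtain ⟨e, rfl⟩ : ∃ e, c = 8 + e := ⟨c - 8, by ring⟩
  have h (i j l : ℕ) : 0 ≤ e ^ i * (w - 8 / 5) ^ j * (4 - w) ^ l :=
    mul_nonneg (mul_nonneg (pow_nonneg (by linarith) i) (pow_nonneg (sub_nonneg.2 hw.1) j))
      (pow_nonneg (sub_nonneg.2 hw.2) l)
  linarith [h 0 0 5, h 0 1 4, h 0 2 3, h 0 3 2, h 0 4 1, h 0 5 0,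
    h 1 0 5, h 1 1 4, h 1 2 3, h 1 3 2, h 1 4 1, h 1 5 0,
    h 2 0 5, h 2 1 4, h 2 2 3, h 2 3 2, h 2 4 1, h 2 5 0,
    h 3 0 5, h 3 1 4, h 3 2 3, h 3 3 2, h 3 4 1, h 3 5 0]

/-- The analogue of `barrier_poly_nonneg_left` for the third quadratic piece, on rays that leave the
polytope through the edge `x = m`. -/
theorem barrier_poly_nonneg_outer {c w : ℝ} (hc : 8 ≤ c) (hw : w ∈ Icc (4 : ℝ) (13 / 2)) :
    0 ≤ (14 / 5 - 3 / 5 * w) * w * (c ^ 2 - w ^ 2) * (c + 1 * w) +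
      (-281 / 50 + 14 / 5 * w - 3 / 10 * w ^ 2) *
      (2 * (c ^ 2 - w ^ 2) * (c + 1 * w) - 2 * (c - 3) * w ^ 2 * (c + 1 * w)
        - 2 * c * 1 * w * (c ^ 2 - w ^ 2)) -
      w * (c ^ 2 - w ^ 2) * (2 * c * (c + 4) - (2 * c + 1) * (c + 1 * w)) := by
  obtain ⟨e, rfl⟩ : ∃ e, c = 8 + e := ⟨c - 8, by ring⟩
  have h (i j l : ℕ) : 0 ≤ e ^ i * (w - 4) ^ j * (13 / 2 - w) ^ l :=
    mul_nonneg (mul_nonneg (pow_nonneg (by linarith) i) (pow_nonneg (sub_nonneg.2 hw.1) j))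
      (pow_nonneg (sub_nonneg.2 hw.2) l)
  linarith [h 0 0 5, h 0 1 4, h 0 2 3, h 0 3 2, h 0 4 1, h 0 5 0,
    h 1 0 5, h 1 1 4, h 1 2 3, h 1 3 2, h 1 4 1, h 1 5 0,
    h 2 0 5, h 2 1 4, h 2 2 3, h 2 3 2, h 2 4 1, h 2 5 0,
    h 3 0 5, h 3 1 4, h 3 2 3, h 3 3 2, h 3 4 1, h 3 5 0]

/-! ### The one-variable inequality -/

/-- The parameter at which the ray labelled `w` leaves the polytope. With `c = 2 m - 4`, the three
terms come from the edges `x + y = 2 m - 3`, `2 x + y = 3 m - 4` and `x = m`. -/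
noncomputable def rayEnd (c w : ℝ) : ℝ :=
  min ((c + 1) / c) (min ((3 * c + 4) / (3 * c + w)) ((c + 4) / (c + w)))

theorem rayEnd_pos {c w : ℝ} (hc : 0 < c) (hw : 0 ≤ w) : 0 < rayEnd c w := by
  unfold rayEnd
  refine lt_min (by positivity) (lt_min (by positivity) (by positivity))

theorem continuousOn_rayEnd {c : ℝ} (hc : 0 < c) : ContinuousOn (rayEnd c) (Ici 0) := by
  have h1 : ContinuousOn (fun w => (3 * c + 4) / (3 * c + w)) (Ici 0) :=
    continuousOn_const.div (by fun_prop) fun w hw => by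
      have : (0 : ℝ) ≤ w := hw
      positivity
  have h2 : ContinuousOn (fun w => (c + 4) / (c + w)) (Ici 0) :=
    continuousOn_const.div (by fun_prop) fun w hw => by
      have : (0 : ℝ) ≤ w := hw
      positivity
  exact continuousOn_const.inf (h1.inf h2)

theorem div_three_mul_add_le {c w : ℝ} (hc : 0 < c) (hw : 0 ≤ w) (h : w ≤ 4) :
    (3 * c + 4) / (3 * c + w) ≤ (c + 4) / (c + w) := by
  rw [div_le_div_iff₀ (by positivity) (by positivity)]
  nlinarith

theorem rayEnd_of_le_div {c w : ℝ} (hc : 0 < c) (hw : 0 ≤ w) (h : w ≤ c / (c + 1)) :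
    rayEnd c w = (c + 1) / c := by
  have h' : w * (c + 1) ≤ c := (le_div_iff₀ (by positivity)).1 h
  have h1 : (c + 1) / c ≤ (3 * c + 4) / (3 * c + w) := by
    rw [div_le_div_iff₀ hc (by positivity)]
    nlinarith
  exact min_eq_left (le_min h1 (h1.trans (div_three_mul_add_le hc hw (by nlinarith))))

theorem rayEnd_of_mem_Icc {c w : ℝ} (hc : 0 < c) (h : c / (c + 1) ≤ w) (h4 : w ≤ 4) :
    rayEnd c w = (3 * c + 4) / (3 * c + w) := by
  have h' : c ≤ w * (c + 1) := (div_le_iff₀ (by positivity)).1 h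
  have hw : 0 ≤ w := le_trans (by positivity) h
  unfold rayEnd
  rw [min_eq_left (div_three_mul_add_le hc hw h4), min_eq_right]
  rw [div_le_div_iff₀ (by positivity) hc]
  nlinarith

theorem rayEnd_of_four_le {c w : ℝ} (hc : 0 < c) (h : 4 ≤ w) :
    rayEnd c w = (c + 4) / (c + w) := by
  have h1 : (c + 4) / (c + w) ≤ (3 * c + 4) / (3 * c + w) := by
    rw [div_le_div_iff₀ (by positivity) (by positivity)]
    nlinarith
  have h2 : (c + 4) / (c + w) ≤ (c + 1) / c := by
    rw [div_le_div_iff₀ (by positivity) hc]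
    nlinarith
  unfold rayEnd
  rw [min_eq_right h1, min_eq_right h2]

theorem hasDerivAt_quadratic (a b d w : ℝ) :
    HasDerivAt (fun t => a + b * t + d * t ^ 2) (b + d * (2 * w)) w := by
  have := (((hasDerivAt_id w).const_mul b).const_add a).add
    (((hasDerivAt_id w).pow 2).const_mul d)
  simpa using! this

theorem rayWeight_pos (n : ℕ) {c w r : ℝ} (hw : 0 < w) (hwc : w < c) (hr : 0 < r) :
    0 < rayWeight n c w r := by
  have : 0 < c ^ 2 - w ^ 2 := by nlinarith
  unfold rayWeight
  positivity

theorem continuousOn_rayWeight_rayEnd (n : ℕ) {c : ℝ} (hc : 0 < c) :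
    ContinuousOn (fun w => rayWeight n c w (rayEnd c w)) (Ici 0) := by
  unfold rayWeight
  exact ContinuousOn.mul (by fun_prop) ((continuousOn_rayEnd hc).pow _)

/-- The one-variable form of the barycenter inequality. The integrand is positive for small `w` and
negative later; the barrier is a quadratic on each of four intervals, jumps up (or is continuous)
at the breakpoints, and is negative at `13 / 2`, after which the integrand stays negative. -/
theorem integral_rayWeight_rayEnd_neg (n : ℕ) {c : ℝ} (hc : 8 ≤ c) (hn : (n : ℝ) = c - 3) :
    ∫ w in (0 : ℝ)..c, rayWeight n c w (rayEnd c w) * (2 * c * rayEnd c w - (2 * c + 1)) < 0 := by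
  have hc0 : 0 < c := by linarith
  set f : ℝ → ℝ := fun w =>
    rayWeight n c w (rayEnd c w) * (2 * c * rayEnd c w - (2 * c + 1)) with hf
  have hcont : ContinuousOn f (Ici 0) :=
    (continuousOn_rayWeight_rayEnd n hc0).mul
      ((continuousOn_const.mul (continuousOn_rayEnd hc0)).sub continuousOn_const)
  have hint (p q : ℝ) (hp : 0 ≤ p) (hq : 0 ≤ q) : IntervalIntegrable f volume p q :=
    (hcont.mono fun x hx => (le_min hp hq).trans hx.1).intervalIntegrable
  set v : ℝ := c / (c + 1) with hv
  have hv0 : 0 < v := by positivity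
  have hv1 : v ≤ 1 := (div_le_one (by positivity)).2 (by linarith)
  have hv8 : 8 / 9 ≤ v := (div_le_div_iff₀ (by norm_num) (by positivity)).2 (by linarith)
  have key (p q a b k B₀ B₁ B₂ : ℝ) (hp : 0 ≤ p) (hpq : p ≤ q) (hq : q ≤ c) (ha : 0 ≤ a)
      (hb : ∀ w ∈ Icc p q, 0 < b + k * w) (hR : ∀ w ∈ Icc p q, rayEnd c w = a / (b + k * w))
      (h : ∀ w ∈ Ioo p q, 2 * c * (a / (b + k * w)) - (2 * c + 1) ≤
        (B₁ + B₂ * (2 * w)) + (B₀ + B₁ * w + B₂ * w ^ 2) *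
        (2 / w - n * (2 * w) / (c ^ 2 - w ^ 2) - (2 * n + 6) * k / (b + k * w))) :
      ∫ w in p..q, f w ≤ rayWeight n c q (rayEnd c q) * (B₀ + B₁ * q + B₂ * q ^ 2) -
        rayWeight n c p (rayEnd c p) * (B₀ + B₁ * p + B₂ * p ^ 2) := by
    rw [hR q (right_mem_Icc.2 hpq), hR p (left_mem_Icc.2 hpq)]
    refine le_of_eq_of_le (intervalIntegral.integral_congr fun w hw => ?_)
      (integral_rayWeight_le n hp hpq hq ha hb (hasDerivAt_quadratic B₀ B₁ B₂) h)
    rw [uIcc_of_le hpq] at hw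
    simp only [hf, hR w hw]
  have hD {w q : ℝ} (hw : 0 < w) (hq : w < q) (hqc : q ≤ c) : 0 < c ^ 2 - w ^ 2 := by nlinarith
  have I1 := key 0 v (c + 1) c 0 0 (7 / 20) 0 le_rfl hv0.le (by linarith) (by positivity)
    (fun w _ => by simpa using hc0)
    (fun w hw => by simpa using rayEnd_of_le_div hc0 hw.1 hw.2) fun w hw => by
      have hwD := hD hw.1 hw.2 (by linarith)
      refine le_of_cleared hw.1 hwD (by linarith) ?_
      have hwv : w * (c + 1) ≤ c := (le_div_iff₀ (by positivity)).1 hw.2.le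
      -- After clearing denominators the claim is `14 n w ^ 2 ≤ c ^ 2 - w ^ 2`; since
      -- `w ≤ c / (c + 1)`, it is enough that `c ^ 2 - 12 c + 42 ≥ 0`.
      have hsq : (w * (c + 1)) ^ 2 ≤ c ^ 2 :=
        pow_le_pow_left₀ (mul_nonneg hw.1.le (by positivity)) hwv 2
      have hgap : 0 ≤ c ^ 2 - w ^ 2 - 14 * (c - 3) * w ^ 2 := by
        nlinarith [mul_nonneg (sq_nonneg w) (sq_nonneg (c - 6)), sq_nonneg w]
      rw [hn]
      linarith [mul_nonneg (mul_pos hw.1 hc0).le hgap]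
  have I2 := key v (8 / 5) (3 * c + 4) (3 * c) 1 (-69 / 200) (183 / 200) (-19 / 100) hv0.le
    (by linarith) (by linarith) (by positivity)
    (fun w hw => by linarith [hw.1])
    (fun w hw => by simpa using rayEnd_of_mem_Icc hc0 hw.1 (by linarith [hw.2])) fun w hw => by
      refine le_of_cleared (hv0.trans hw.1) (hD (hv0.trans hw.1) hw.2 (by linarith))
        (by linarith [hw.1]) ?_
      rw [hn]
      linarith [barrier_poly_nonneg_left hc ⟨hv8.trans hw.1.le, hw.2.le⟩]
  have I3 := key (8 / 5) 4 (3 * c + 4) (3 * c) 1 (-1 / 10) (31 / 50) (-1 / 10) (by norm_num)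
    (by norm_num) (by linarith) (by positivity)
    (fun w hw => by linarith [hw.1])
    (fun w hw => by simpa using rayEnd_of_mem_Icc hc0 (by linarith [hw.1]) hw.2) fun w hw => by
      have hw0 : 0 < w := by linarith [hw.1]
      refine le_of_cleared hw0 (hD hw0 hw.2 (by linarith)) (by linarith) ?_
      rw [hn]
      linarith [barrier_poly_nonneg_right hc ⟨hw.1.le, hw.2.le⟩]
  have I4 := key 4 (13 / 2) (c + 4) c 1 (-281 / 50) (14 / 5) (-3 / 10) (by norm_num)
    (by norm_num) (by linarith) (by positivity)
    (fun w hw => by linarith [hw.1])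
    (fun w hw => by simpa using rayEnd_of_four_le hc0 hw.1) fun w hw => by
      have hw0 : 0 < w := by linarith [hw.1]
      refine le_of_cleared hw0 (hD hw0 hw.2 (by linarith)) (by linarith) ?_
      rw [hn]
      linarith [barrier_poly_nonneg_outer hc ⟨hw.1.le, hw.2.le⟩]
  have I5 := key (13 / 2) c (c + 4) c 1 0 0 0 (by norm_num)
    (by linarith) le_rfl (by positivity)
    (fun w hw => by linarith [hw.1])
    (fun w hw => by simpa using rayEnd_of_four_le hc0 (by linarith [hw.1])) fun w hw => by
      have hw0 : 0 < w := by linarith [hw.1]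
      refine le_of_cleared hw0 (hD hw0 hw.2 le_rfl) (by linarith) ?_
      have := mul_pos hw0 (hD hw0 hw.2 le_rfl)
      linarith [mul_nonneg this.le
        (show 0 ≤ (2 * c + 1) * w - 7 * c by nlinarith [hw.1])]
  have hsum : ∫ w in (0 : ℝ)..c, f w = (∫ w in (0 : ℝ)..v, f w) + (∫ w in v..(8 / 5), f w) +
      (∫ w in (8 / 5 : ℝ)..4, f w) + (∫ w in (4 : ℝ)..(13 / 2), f w) +
      ∫ w in (13 / 2 : ℝ)..c, f w := by
    rw [intervalIntegral.integral_add_adjacent_intervals (hint _ _ le_rfl hv0.le)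
      (hint _ _ hv0.le (by norm_num)),
      intervalIntegral.integral_add_adjacent_intervals (hint _ _ le_rfl (by norm_num))
      (hint _ _ (by norm_num) (by norm_num)),
      intervalIntegral.integral_add_adjacent_intervals (hint _ _ le_rfl (by norm_num))
      (hint _ _ (by norm_num) (by norm_num)),
      intervalIntegral.integral_add_adjacent_intervals (hint _ _ le_rfl (by norm_num))
      (hint _ _ (by norm_num) hc0.le)]
  have hW (w : ℝ) (hw : 0 < w) (hwc : w < c) : 0 < rayWeight n c w (rayEnd c w) :=
    rayWeight_pos n hw hwc (rayEnd_pos hc0 hw.le)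
  -- The barrier jumps up at `v`.
  have J1 := mul_nonneg (hW v hv0 (by linarith)).le
    (show 0 ≤ -69 / 200 + (183 / 200 - 7 / 20) * v - 19 / 100 * v ^ 2 by nlinarith)
  have J2 := hW (8 / 5) (by norm_num) (by linarith)
  have J4 := hW (13 / 2) (by norm_num) (by linarith)
  rw [hsum]
  linarith

/-! ### Integration along rays -/

/-- The polytope as an intersection of half-planes, with `c = 2 m - 4`. -/
def sectorRegion (c : ℝ) : Set (ℝ × ℝ) :=
  {p | 0 ≤ p.2 ∧ p.2 ≤ p.1 ∧ p.1 ≤ (c + 4) / 2 ∧ 2 * p.1 + p.2 ≤ (3 * c + 4) / 2 ∧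
    p.1 + p.2 ≤ c + 1}

/-- Coordinates `(w, ρ)` adapted to rays from the origin, returning `(x, y)`: `w` labels the ray,
`x + y = c ρ` and `x - y = ρ w`. The line `x + y = c` is `ρ = 1`. -/
noncomputable def rayMap (c : ℝ) (q : ℝ × ℝ) : ℝ × ℝ :=
  (q.2 * (c + q.1) / 2, q.2 * (c - q.1) / 2)

/-- The derivative of `rayMap`, see `hasFDerivAt_rayMap`. -/
noncomputable def rayMapDeriv (c : ℝ) (q : ℝ × ℝ) : ℝ × ℝ →L[ℝ] ℝ × ℝ :=
  (Matrix.toLin (.finTwoProd ℝ) (.finTwoProd ℝ)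
    !![q.2 / 2, (c + q.1) / 2; -q.2 / 2, (c - q.1) / 2]).toContinuousLinearMap

theorem hasFDerivAt_rayMap (c : ℝ) (q : ℝ × ℝ) :
    HasFDerivAt (rayMap c) (rayMapDeriv c q) q := by
  unfold rayMapDeriv
  rw [Matrix.toLin_finTwoProd_toContinuousLinearMap]
  have h1 : HasFDerivAt (fun q : ℝ × ℝ => q.1) (ContinuousLinearMap.fst ℝ ℝ ℝ) q := hasFDerivAt_fst
  have h2 : HasFDerivAt (fun q : ℝ × ℝ => q.2) (ContinuousLinearMap.snd ℝ ℝ ℝ) q := hasFDerivAt_snd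
  have ha := ((h2.mul (h1.const_add c)).mul_const (1 / 2 : ℝ))
  have hb := ((h2.mul (h1.const_sub c)).mul_const (1 / 2 : ℝ))
  have := ha.prodMk hb
  refine (this.congr_fderiv ?_).congr_of_eventuallyEq (.of_forall fun q => ?_)
  · ext <;> simp <;> ring
  · simp only [rayMap, Prod.mk.injEq, Pi.mul_apply]
    constructor <;> ring

theorem det_rayMapDeriv (c : ℝ) (q : ℝ × ℝ) : (rayMapDeriv c q).det = q.2 * c / 2 := by
  unfold rayMapDeriv
  simp only [LinearMap.det_toContinuousLinearMap, LinearMap.det_toLin, Matrix.det_fin_two_of]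
  ring

theorem injOn_rayMap {c : ℝ} (hc : 0 < c) : InjOn (rayMap c) (Icc 0 c ×ˢ Ioi 0) := by
  rintro ⟨w, ρ⟩ ⟨-, hρ⟩ ⟨w', ρ'⟩ - h
  simp only [rayMap, Prod.mk.injEq] at h
  have hρ0 : 0 < ρ := hρ
  have h1 : ρ = ρ' := mul_right_cancel₀ hc.ne' (by linarith [h.1, h.2])
  subst h1
  have h2 : w = w' := mul_left_cancel₀ hρ0.ne' (by linarith [h.1, h.2])
  rw [h2]

theorem image_rayMap {c : ℝ} (hc : 0 < c) :
    rayMap c '' (Icc 0 c ×ˢ Ioi 0) = {p | 0 ≤ p.2 ∧ p.2 ≤ p.1} \ {0} := by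
  ext ⟨x, y⟩
  constructor
  · rintro ⟨⟨w, ρ⟩, ⟨⟨hw0, hwc⟩, hρ⟩, h⟩
    have hρ0 : 0 < ρ := hρ
    simp only [rayMap, Prod.mk.injEq] at h hw0 hwc
    obtain ⟨rfl, rfl⟩ := h
    refine ⟨⟨?_, ?_⟩, fun h => ?_⟩
    · exact div_nonneg (mul_nonneg hρ0.le (by linarith)) (by norm_num)
    · nlinarith
    · simp only [mem_singleton_iff, Prod.mk_eq_zero] at h
      nlinarith [h.1]
  · rintro ⟨⟨hy, hyx⟩, hne⟩
    simp only at hy hyx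
    have hs : 0 < x + y := by
      rcases (show 0 ≤ x by linarith).eq_or_lt with h | h
      · exact absurd (by simp [Prod.ext_iff, ← h]; linarith) hne
      · linarith
    refine ⟨(c * (x - y) / (x + y), (x + y) / c), ⟨⟨?_, ?_⟩, ?_⟩, ?_⟩
    · exact div_nonneg (mul_nonneg hc.le (by linarith)) hs.le
    · rw [div_le_iff₀ hs]
      nlinarith
    · exact div_pos hs hc
    · simp only [rayMap, Prod.mk.injEq]
      constructor <;> · field_simp; ring

theorem rayMap_mem_sectorRegion_iff {c w ρ : ℝ} (hc : 0 < c) (hw : w ∈ Icc 0 c) (hρ : 0 < ρ) :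
    rayMap c (w, ρ) ∈ sectorRegion c ↔ ρ ≤ rayEnd c w := by
  obtain ⟨hw0, hwc⟩ := hw
  have h1 : 0 ≤ ρ * (c - w) := mul_nonneg hρ.le (by linarith)
  have h2 : 0 ≤ ρ * w := mul_nonneg hρ.le hw0
  simp only [sectorRegion, rayMap, rayEnd, mem_ofPred_eq, le_min_iff]
  rw [le_div_iff₀ hc, le_div_iff₀ (show 0 < 3 * c + w by positivity),
    le_div_iff₀ (show 0 < c + w by positivity)]
  constructor
  · rintro ⟨-, -, h3, h4, h5⟩
    refine ⟨?_, ?_, ?_⟩ <;> linarith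
  · rintro ⟨h3, h4, h5⟩
    refine ⟨?_, ?_, ?_, ?_, ?_⟩ <;> linarith

theorem isClosed_sectorRegion (c : ℝ) : IsClosed (sectorRegion c) := by
  unfold sectorRegion
  simp only [ofPred_and]
  refine ((isClosed_le ?_ ?_).inter ((isClosed_le ?_ ?_).inter ((isClosed_le ?_ ?_).inter
    ((isClosed_le ?_ ?_).inter (isClosed_le ?_ ?_))))) <;> fun_prop

theorem isCompact_sectorRegion (c : ℝ) : IsCompact (sectorRegion c) := by
  refine Metric.isCompact_of_isClosed_isBounded (isClosed_sectorRegion c) ?_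
  refine (Metric.isBounded_Icc ((0 : ℝ), (0 : ℝ)) ((c + 4) / 2, (c + 4) / 2)).subset ?_
  rintro ⟨x, y⟩ ⟨h1, h2, h3, -⟩
  simp only at h1 h2 h3
  refine ⟨⟨?_, ?_⟩, ⟨?_, ?_⟩⟩ <;> simp only <;> linarith

theorem integral_sectorRegion {c : ℝ} (hc : 0 < c) {g : ℝ × ℝ → ℝ} (hg : Continuous g) :
    ∫ p in sectorRegion c, g p = ∫ w in (0 : ℝ)..c, ∫ ρ in (0 : ℝ)..rayEnd c w,
      ρ * c / 2 * g (ρ * (c + w) / 2, ρ * (c - w) / 2) := by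
  set T : Set (ℝ × ℝ) := Icc 0 c ×ˢ Ioi 0 with hT
  have hTm : MeasurableSet T := measurableSet_Icc.prod measurableSet_Ioi
  have hSm : MeasurableSet (sectorRegion c) := (isClosed_sectorRegion c).measurableSet
  have hae : (sectorRegion c ∩ rayMap c '' T : Set (ℝ × ℝ)) =ᵐ[volume] sectorRegion c := by
    rw [hT, image_rayMap hc]
    have : sectorRegion c ∩ ({p | 0 ≤ p.2 ∧ p.2 ≤ p.1} \ {0}) = sectorRegion c \ {0} := by
      ext p
      simp only [sectorRegion, mem_inter_iff, mem_sdiff, mem_ofPred_eq]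
      tauto
    rw [this]
    exact sdiff_null_ae_eq_self (measure_singleton _)
  have hd (q : ℝ × ℝ) (_ : q ∈ T) : HasFDerivWithinAt (rayMap c) (rayMapDeriv c q) T q :=
    (hasFDerivAt_rayMap c q).hasFDerivWithinAt
  have hint : IntegrableOn ((sectorRegion c).indicator g) (rayMap c '' T) :=
    ((integrable_indicator_iff hSm).2
      (hg.continuousOn.integrableOn_compact (isCompact_sectorRegion c))).integrableOn
  have hint' := (integrableOn_image_iff_integrableOn_abs_det_fderiv_smul volume hTm hd
    (injOn_rayMap hc) _).1 hint
  calc ∫ p in sectorRegion c, g p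
      = ∫ p in rayMap c '' T, (sectorRegion c).indicator g p := by
        rw [setIntegral_indicator hSm, inter_comm, setIntegral_congr_set hae]
    _ = ∫ q in T, |(rayMapDeriv c q).det| • (sectorRegion c).indicator g (rayMap c q) :=
        integral_image_eq_integral_abs_det_fderiv_smul volume hTm hd (injOn_rayMap hc) _
    _ = ∫ w in Icc 0 c, ∫ ρ in Ioi 0, |(rayMapDeriv c (w, ρ)).det| •
          (sectorRegion c).indicator g (rayMap c (w, ρ)) := setIntegral_prod _ hint'
    _ = ∫ w in Icc 0 c, ∫ ρ in (0 : ℝ)..rayEnd c w,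
          ρ * c / 2 * g (ρ * (c + w) / 2, ρ * (c - w) / 2) := by
        refine setIntegral_congr_fun measurableSet_Icc fun w hw => ?_
        rw [intervalIntegral.integral_of_le (rayEnd_pos hc hw.1).le,
          ← Ioi_inter_Iic, ← setIntegral_indicator measurableSet_Iic]
        refine setIntegral_congr_fun measurableSet_Ioi fun ρ hρ => ?_
        have hρ0 : 0 < ρ := hρ
        simp only [det_rayMapDeriv, indicator, mem_Iic, smul_eq_mul,
          rayMap_mem_sectorRegion_iff hc hw hρ0]
        rw [abs_of_pos (by positivity)]
        split_ifs
        · rfl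
        · simp
    _ = _ := by
        rw [intervalIntegral.integral_of_le hc.le, integral_Icc_eq_integral_Ioc]

/-- The Duistermaat–Heckman density up to a positive constant, with `n = 2 m - 7`. -/
noncomputable def polyDensity (n : ℕ) (p : ℝ × ℝ) : ℝ :=
  p.1 ^ n * p.2 ^ n * (p.1 + p.2) ^ 2 * (p.1 - p.2) ^ 2

theorem continuous_polyDensity (n : ℕ) : Continuous (polyDensity n) := by
  unfold polyDensity
  fun_prop

theorem polyDensity_ray (n : ℕ) (c w ρ : ℝ) :
    polyDensity n (ρ * (c + w) / 2, ρ * (c - w) / 2) =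
      c ^ 2 / 4 ^ n * (w ^ 2 * (c ^ 2 - w ^ 2) ^ n) * ρ ^ (2 * n + 4) := by
  have : (ρ * (c + w) / 2) ^ n * (ρ * (c - w) / 2) ^ n =
      ρ ^ (2 * n) * (c ^ 2 - w ^ 2) ^ n / 4 ^ n := by
    rw [← mul_pow, pow_mul, ← mul_pow, ← div_pow]
    congr 1
    ring
  simp only [polyDensity]
  rw [this]
  ring

theorem integral_polyDensity_pos (n : ℕ) {c : ℝ} (hc : 0 < c) :
    0 < ∫ p in sectorRegion c, polyDensity n p := by
  rw [integral_sectorRegion hc (continuous_polyDensity n)]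
  have h (w : ℝ) : ∫ ρ in (0 : ℝ)..rayEnd c w,
      ρ * c / 2 * polyDensity n (ρ * (c + w) / 2, ρ * (c - w) / 2) =
      c ^ 3 / (2 * 4 ^ n * (2 * n + 6)) * rayWeight n c w (rayEnd c w) := by
    have : ∀ ρ : ℝ, ρ * c / 2 * polyDensity n (ρ * (c + w) / 2, ρ * (c - w) / 2) =
        c ^ 3 / (2 * 4 ^ n) * (w ^ 2 * (c ^ 2 - w ^ 2) ^ n) * ρ ^ (2 * n + 5) := fun ρ => by
      rw [polyDensity_ray]
      field_simp
      ring
    simp only [this]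
    rw [intervalIntegral.integral_const_mul, integral_pow]
    unfold rayWeight
    push_cast
    field_simp
    ring
  simp only [h]
  rw [intervalIntegral.integral_const_mul]
  refine mul_pos (by positivity) (intervalIntegral.intervalIntegral_pos_of_pos_on ?_ ?_ hc)
  · exact ((continuousOn_rayWeight_rayEnd n hc).mono fun x hx =>
      (le_min le_rfl hc.le).trans hx.1).intervalIntegrable
  · exact fun w hw => rayWeight_pos n hw.1 hw.2 (rayEnd_pos hc hw.1.le)

theorem integral_mul_polyDensity_neg (n : ℕ) {c : ℝ} (hc : 8 ≤ c) (hn : (n : ℝ) = c - 3) :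
    ∫ p in sectorRegion c, (p.1 + p.2 - c) * polyDensity n p < 0 := by
  have hc0 : 0 < c := by linarith
  have hcont := continuous_polyDensity n
  rw [integral_sectorRegion hc0 (by fun_prop)]
  have h (w : ℝ) : ∫ ρ in (0 : ℝ)..rayEnd c w, ρ * c / 2 *
      ((ρ * (c + w) / 2 + ρ * (c - w) / 2 - c) *
        polyDensity n (ρ * (c + w) / 2, ρ * (c - w) / 2)) =
      c ^ 4 / (2 * 4 ^ n * (2 * c) * (2 * c + 1)) * (rayWeight n c w (rayEnd c w) *
        (2 * c * rayEnd c w - (2 * c + 1))) := by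
    have : ∀ ρ : ℝ, ρ * c / 2 * ((ρ * (c + w) / 2 + ρ * (c - w) / 2 - c) *
        polyDensity n (ρ * (c + w) / 2, ρ * (c - w) / 2)) =
        c ^ 4 / (2 * 4 ^ n) * (w ^ 2 * (c ^ 2 - w ^ 2) ^ n) *
          (ρ ^ (2 * n + 6) - ρ ^ (2 * n + 5)) := fun ρ => by
      rw [polyDensity_ray]
      field_simp
      ring
    simp only [this]
    rw [intervalIntegral.integral_const_mul, intervalIntegral.integral_sub (by simp) (by simp),
      integral_pow, integral_pow]
    have h6 : ((2 * n + 5 : ℕ) : ℝ) + 1 = 2 * c := by push_cast; linarith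
    have h7 : ((2 * n + 6 : ℕ) : ℝ) + 1 = 2 * c + 1 := by push_cast; linarith
    rw [h6, h7]
    unfold rayWeight
    field_simp
    ring
  simp only [h]
  rw [intervalIntegral.integral_const_mul]
  exact mul_neg_of_pos_of_neg (by positivity) (integral_rayWeight_rayEnd_neg n hc hn)

/-! ### The Duistermaat–Heckman density -/

theorem thetaIdx_of_mem {m k : ℕ} (h : k ≠ 1 ∧ k ≠ 2 ∧ k ≠ m - 1 ∧ k ≠ m) : thetaIdx m k = k := by
  simp [thetaIdx, h]

theorem root_apply (i j k : ℕ) :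
    root i j k = (if k = i then 1 else 0) - (if k = j then 1 else 0) := by
  simp [root, Pi.single_apply]

theorem theta_root_ne_iff {m i j : ℕ} (hm : 6 ≤ m) (hi : 1 ≤ i) (hij : i < j) (hj : j ≤ m) :
    theta m (root i j) ≠ root i j ↔ i ≤ 2 ∨ m - 1 ≤ j := by
  constructor
  · intro h
    by_contra! hc
    refine h (funext fun k => ?_)
    by_cases hk : k ≠ 1 ∧ k ≠ 2 ∧ k ≠ m - 1 ∧ k ≠ m
    · rw [theta, thetaIdx_of_mem hk]
    · have h1 : thetaIdx m k ≠ i ∧ thetaIdx m k ≠ j ∧ k ≠ i ∧ k ≠ j := by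
        unfold thetaIdx
        split_ifs <;> omega
      simp [theta, root_apply, h1]
  · intro h heq
    have e1 := congrFun heq 1
    have e2 := congrFun heq 2
    have e3 := congrFun heq (m - 1)
    have e4 := congrFun heq m
    have t1 : thetaIdx m 1 = m := by simp [thetaIdx]
    have t2 : thetaIdx m 2 = m - 1 := by simp [thetaIdx]
    have t3 : thetaIdx m (m - 1) = 2 := by
      unfold thetaIdx
      split_ifs <;> omega
    have t4 : thetaIdx m m = 1 := by
      unfold thetaIdx
      split_ifs <;> omega
    simp only [theta, root_apply, t1, t2, t3, t4] at e1 e2 e3 e4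
    have hcase : i = 1 ∨ i = 2 ∨ j = m ∨ j = m - 1 := by omega
    rcases hcase with rfl | rfl | rfl | rfl
    · rw [if_neg (by omega : ¬ m = 1), if_pos rfl, if_neg (by omega : ¬ 1 = j)] at e1
      split_ifs at e1 <;> norm_num at e1
    · rw [if_neg (by omega : ¬ m - 1 = 2), if_pos rfl, if_neg (by omega : ¬ 2 = j)] at e2
      split_ifs at e2 <;> norm_num at e2
    · rw [if_neg (by omega : ¬ 1 = j), if_pos rfl, if_neg (by omega : ¬ j = i)] at e4
      split_ifs at e4 <;> norm_num at e4
    · rw [if_neg (by omega : ¬ 2 = m - 1), if_pos rfl, if_neg (by omega : ¬ m - 1 = i)] at e3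
      split_ifs at e3 <;> norm_num at e3

/-- The roots moved by `θ`: six roots supported on `{1, 2, m - 1, m}`, and those that join one of
these indices to one of `3, …, m - 2`. -/
theorem movedPosRoots_eq {m : ℕ} (hm : 6 ≤ m) :
    movedPosRoots m =
      {(1, 2), (m - 1, m), (1, m - 1), (2, m), (1, m), (2, m - 1)} ∪
        ({1, 2} ×ˢ Finset.Icc 3 (m - 2) ∪ Finset.Icc 3 (m - 2) ×ˢ {m - 1, m}) := by
  ext ⟨i, j⟩
  have h : (i, j) ∈ movedPosRoots m ↔ (1 ≤ i ∧ i < j ∧ j ≤ m) ∧ (i ≤ 2 ∨ m - 1 ≤ j) := by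
    simp only [movedPosRoots, Finset.mem_filter, Finset.mem_product, Finset.mem_Icc]
    constructor
    · rintro ⟨⟨⟨h1, -⟩, -, h2⟩, h3, h4⟩
      exact ⟨⟨h1, h3, h2⟩, (theta_root_ne_iff hm h1 h3 h2).1 h4⟩
    · rintro ⟨⟨h1, h3, h2⟩, h4⟩
      exact ⟨⟨⟨h1, by omega⟩, by omega, h2⟩, h3, (theta_root_ne_iff hm h1 h3 h2).2 h4⟩
  rw [h]
  simp only [Finset.mem_union, Finset.mem_insert, Finset.mem_singleton, Finset.mem_product,
    Finset.mem_Icc, Prod.mk.injEq]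
  omega

theorem killing_root {m i j : ℕ} (hi : i ∈ Finset.Icc 1 m) (hj : j ∈ Finset.Icc 1 m)
    (u : ℕ → ℝ) : killing m (root i j) u = (2 * (m : ℝ))⁻¹ * (u i - u j) := by
  unfold killing
  simp only [root_apply, sub_mul, ite_mul, one_mul, zero_mul, Finset.sum_sub_distrib,
    Finset.sum_ite_eq', hi, hj, if_true]

theorem weight_apply {m : ℕ} (hm : 6 ≤ m) (p : ℝ × ℝ) :
    weight m p 1 = p.1 ∧ weight m p 2 = p.2 ∧ weight m p (m - 1) = -p.2 ∧
      weight m p m = -p.1 ∧ ∀ k ∈ Finset.Icc 3 (m - 2), weight m p k = 0 := by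
  have h (k : ℕ) : weight m p k = p.1 * ((if k = 1 then 1 else 0) - (if k = m then 1 else 0)) +
      p.2 * ((if k = 2 then 1 else 0) - (if k = m - 1 then 1 else 0)) := by
    simp [weight, root_apply]
  have a1 : m ≠ 1 ∧ m ≠ 2 ∧ m ≠ m - 1 ∧ m - 1 ≠ 1 ∧ m - 1 ≠ 2 := by omega
  refine ⟨?_, ?_, ?_, ?_, fun k hk => ?_⟩
  · simp [h, a1.1.symm, a1.2.2.2.1.symm]
  · simp [h, a1.2.1.symm, a1.2.2.2.2.symm]
  · simp [h, a1.2.2.1.symm, a1.2.2.2]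
  · simp [h, a1]
  · rw [Finset.mem_Icc] at hk
    have : k ≠ 1 ∧ k ≠ 2 ∧ k ≠ m - 1 ∧ k ≠ m := by omega
    simp [h, this]

theorem exists_dhDensity_eq {m : ℕ} (hm : 6 ≤ m) :
    ∃ K : ℝ, 0 < K ∧ ∀ p, dhDensity m p = K * polyDensity (2 * m - 7) p := by
  refine ⟨4 * ((2 * (m : ℝ))⁻¹) ^ (6 + 4 * (m - 4)), by positivity, fun p => ?_⟩
  obtain ⟨w1, w2, w3, w4, w0⟩ := weight_apply hm p
  set r : ℝ := (2 * (m : ℝ))⁻¹ with hr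
  have hprod : dhDensity m p =
      ∏ a ∈ movedPosRoots m, r * (weight m p a.1 - weight m p a.2) := by
    refine Finset.prod_congr rfl fun a ha => ?_
    simp only [movedPosRoots, Finset.mem_filter, Finset.mem_product] at ha
    exact killing_root ha.1.1 ha.1.2 _
  have hcard : (Finset.Icc 3 (m - 2)).card = m - 4 := by rw [Nat.card_Icc]; omega
  have d1 : Disjoint ({(1, 2), (m - 1, m), (1, m - 1), (2, m), (1, m), (2, m - 1)} : Finset (ℕ × ℕ))
      ({1, 2} ×ˢ Finset.Icc 3 (m - 2) ∪ Finset.Icc 3 (m - 2) ×ˢ {m - 1, m}) := by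
    rw [Finset.disjoint_left]
    rintro ⟨i, j⟩ h h'
    simp only [Finset.mem_union, Finset.mem_insert, Finset.mem_singleton, Finset.mem_product,
      Finset.mem_Icc, Prod.mk.injEq] at h h'
    omega
  have d2 : Disjoint (({1, 2} : Finset ℕ) ×ˢ Finset.Icc 3 (m - 2))
      (Finset.Icc 3 (m - 2) ×ˢ {m - 1, m}) := by
    rw [Finset.disjoint_left]
    rintro ⟨i, j⟩ h h'
    simp only [Finset.mem_insert, Finset.mem_singleton, Finset.mem_product, Finset.mem_Icc] at h h'
    omega
  have q1 : ∏ k ∈ Finset.Icc 3 (m - 2), r * (p.1 - weight m p k) = (r * p.1) ^ (m - 4) := by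
    rw [Finset.prod_congr rfl fun k hk => by rw [w0 k hk, sub_zero], Finset.prod_const, hcard]
  have q2 : ∏ k ∈ Finset.Icc 3 (m - 2), r * (p.2 - weight m p k) = (r * p.2) ^ (m - 4) := by
    rw [Finset.prod_congr rfl fun k hk => by rw [w0 k hk, sub_zero], Finset.prod_const, hcard]
  have q3 : ∏ k ∈ Finset.Icc 3 (m - 2),
      (r * (weight m p k - -p.2)) * (r * (weight m p k - -p.1)) =
        (r * p.2 * (r * p.1)) ^ (m - 4) := by
    rw [Finset.prod_congr rfl fun k hk => by rw [w0 k hk, zero_sub, zero_sub, neg_neg, neg_neg],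
      Finset.prod_const, hcard]
  rw [hprod, movedPosRoots_eq hm, Finset.prod_union d1, Finset.prod_union d2,
    Finset.prod_product, Finset.prod_product, Finset.prod_pair (by norm_num)]
  simp only [Finset.prod_pair (show m - 1 ≠ m by omega)]
  rw [Finset.prod_insert (by simp; omega), Finset.prod_insert (by simp; omega),
    Finset.prod_insert (by simp; omega), Finset.prod_insert (by simp; omega),
    Finset.prod_insert (by simp), Finset.prod_singleton]
  simp only [w1, w2, w3, w4, q1, q2, q3]
  obtain ⟨l, rfl⟩ : ∃ l, m = l + 4 := ⟨m - 4, by omega⟩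
  have e : 2 * (l + 4) - 7 = 2 * l + 1 := by omega
  rw [e, Nat.add_sub_cancel]
  simp only [polyDensity]
  ring_nf

/-! ### The moment polytope and its barycenter -/

theorem add_smul_mem_of_triangle {s : Set (ℝ × ℝ)} (hs : Convex ℝ s) {u v : ℝ × ℝ}
    (h0 : (0 : ℝ × ℝ) ∈ s) (hu : u ∈ s) (hv : v ∈ s) {a b : ℝ} (ha : 0 ≤ a) (hb : 0 ≤ b)
    (hab : a + b ≤ 1) : a • u + b • v ∈ s := by
  have := hs.sum_mem (t := Finset.univ) (w := ![1 - a - b, a, b]) (z := ![0, u, v])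
    (by intro i _; fin_cases i <;> simp <;> linarith) (by simp [Fin.sum_univ_three]; ring)
    (by intro i _; fin_cases i <;> simpa)
  simpa [Fin.sum_univ_three] using this

theorem blowupPolytope_eq {m : ℕ} (hm : 6 ≤ m) :
    blowupPolytope m = sectorRegion (2 * (m : ℝ) - 4) := by
  have hm' : (6 : ℝ) ≤ m := by exact_mod_cast hm
  obtain ⟨M, hM⟩ : ∃ M : ℝ, M = m := ⟨_, rfl⟩
  rw [← hM] at hm' ⊢
  apply subset_antisymm
  · refine convexHull_min ?_ ?_
    · rw [← hM]
      rintro p (rfl | rfl | rfl | rfl | rfl) <;> refine ⟨?_, ?_, ?_, ?_, ?_⟩ <;>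
        simp only <;> linarith
    · intro p hp q hq a b ha hb hab
      obtain ⟨h1, h2, h3, h4, h5⟩ := hp
      obtain ⟨k1, k2, k3, k4, k5⟩ := hq
      have hb' : b = 1 - a := by linarith
      subst hb'
      refine ⟨?_, ?_, ?_, ?_, ?_⟩ <;>
        simp only [Prod.fst_add, Prod.snd_add, Prod.smul_fst, Prod.smul_snd, smul_eq_mul] <;>
        nlinarith
  · rintro ⟨x, y⟩ ⟨h1, h2, h3, h4, h5⟩
    simp only at h1 h2 h3 h4 h5
    have hc : Convex ℝ (blowupPolytope m) := convex_convexHull ℝ _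
    have v0 : (0 : ℝ × ℝ) ∈ blowupPolytope m := subset_convexHull ℝ _ (Or.inl rfl)
    have v1 : ((M, 0) : ℝ × ℝ) ∈ blowupPolytope m := subset_convexHull ℝ _ (by simp [hM])
    have v2 : ((M, M - 4) : ℝ × ℝ) ∈ blowupPolytope m := subset_convexHull ℝ _ (by simp [hM])
    have v3 : ((M - 1, M - 2) : ℝ × ℝ) ∈ blowupPolytope m := subset_convexHull ℝ _ (by simp [hM])
    have v4 : ((M - 3 / 2, M - 3 / 2) : ℝ × ℝ) ∈ blowupPolytope m :=
      subset_convexHull ℝ _ (by simp [hM])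
    -- The rays through the vertices cut the polytope into three triangles with apex at the origin.
    rcases le_total (y * M) (x * (M - 4)) with s1 | s1
    · have e1 : 0 < M := by linarith
      have e2 : 0 < M - 4 := by linarith
      have := add_smul_mem_of_triangle hc v0 v1 v2 (a := x / M - y / (M - 4)) (b := y / (M - 4))
        (sub_nonneg.2 ((div_le_div_iff₀ e2 e1).2 s1)) (div_nonneg h1 e2.le)
        (by rw [sub_add_cancel, div_le_one e1]; linarith)
      convert! this using 1
      ext
      · change x = (x / M - y / (M - 4)) * M + y / (M - 4) * M
        rw [← add_mul, sub_add_cancel, div_mul_cancel₀ _ e1.ne']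
      · change y = (x / M - y / (M - 4)) * 0 + y / (M - 4) * (M - 4)
        rw [mul_zero, zero_add, div_mul_cancel₀ _ e2.ne']
    rcases le_total (y * (M - 1)) (x * (M - 2)) with s2 | s2
    · -- The determinant of the two spanning vertices is `3 M - 4`.
      have hd : 0 < 3 * M - 4 := by linarith
      have := add_smul_mem_of_triangle hc v0 v2 v3
        (a := (x * (M - 2) - y * (M - 1)) / (3 * M - 4)) (b := (y * M - x * (M - 4)) / (3 * M - 4))
        (div_nonneg (by linarith) hd.le) (div_nonneg (by linarith) hd.le) (by
          rw [← add_div, div_le_one hd]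
          linarith)
      convert! this using 1
      ext
      · change x = (x * (M - 2) - y * (M - 1)) / (3 * M - 4) * M +
          (y * M - x * (M - 4)) / (3 * M - 4) * (M - 1)
        rw [div_mul_eq_mul_div, div_mul_eq_mul_div, ← add_div, eq_div_iff hd.ne']
        ring
      · change y = (x * (M - 2) - y * (M - 1)) / (3 * M - 4) * (M - 4) +
          (y * M - x * (M - 4)) / (3 * M - 4) * (M - 2)
        rw [div_mul_eq_mul_div, div_mul_eq_mul_div, ← add_div, eq_div_iff hd.ne']
        ring
    · have hd : 0 < M - 3 / 2 := by linarith
      have := add_smul_mem_of_triangle hc v0 v3 v4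
        (a := x - y) (b := (y * (M - 1) - x * (M - 2)) / (M - 3 / 2))
        (by linarith) (div_nonneg (by linarith) hd.le) (by
          rw [← le_sub_iff_add_le', div_le_iff₀ hd]
          linarith)
      convert! this using 1
      ext
      · change x = (x - y) * (M - 1) +
          (y * (M - 1) - x * (M - 2)) / (M - 3 / 2) * (M - 3 / 2)
        rw [div_mul_cancel₀ _ hd.ne']
        ring
      · change y = (x - y) * (M - 2) +
          (y * (M - 1) - x * (M - 2)) / (M - 3 / 2) * (M - 3 / 2)
        rw [div_mul_cancel₀ _ hd.ne']
        ring

end AIIITwo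

theorem proposition4p3 (m : ℕ) (hm : 6 ≤ m) :
    0 < AIIITwo.dhVolume m (AIIITwo.blowupPolytope m) ∧
      (AIIITwo.dhBarycenter m (AIIITwo.blowupPolytope m)).1 +
        (AIIITwo.dhBarycenter m (AIIITwo.blowupPolytope m)).2 < 2 * (m : ℝ) - 4 := by
  obtain ⟨K, hK, hP⟩ := AIIITwo.exists_dhDensity_eq hm
  have hm' : (6 : ℝ) ≤ m := by exact_mod_cast hm
  have hn : ((2 * m - 7 : ℕ) : ℝ) = 2 * (m : ℝ) - 4 - 3 := by
    rw [Nat.cast_sub (by omega)]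
    push_cast
    ring
  have hcont : Continuous (AIIITwo.dhDensity m) := by
    rw [funext hP]
    exact continuous_const.mul (AIIITwo.continuous_polyDensity _)
  have hV : 0 < AIIITwo.dhVolume m (AIIITwo.blowupPolytope m) := by
    unfold AIIITwo.dhVolume
    simp only [AIIITwo.blowupPolytope_eq hm, hP]
    rw [integral_const_mul]
    exact mul_pos hK (AIIITwo.integral_polyDensity_pos _ (by linarith))
  refine ⟨hV, ?_⟩
  have hint {g : ℝ × ℝ → ℝ} (hg : Continuous g) :
      IntegrableOn g (AIIITwo.blowupPolytope m) := by
    rw [AIIITwo.blowupPolytope_eq hm]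
    exact hg.continuousOn.integrableOn_compact (AIIITwo.isCompact_sectorRegion _)
  have hneg : ∫ p in AIIITwo.blowupPolytope m,
      (p.1 + p.2 - (2 * (m : ℝ) - 4)) * AIIITwo.dhDensity m p < 0 := by
    have h (p : ℝ × ℝ) : (p.1 + p.2 - (2 * (m : ℝ) - 4)) * AIIITwo.dhDensity m p =
        K * ((p.1 + p.2 - (2 * (m : ℝ) - 4)) * AIIITwo.polyDensity (2 * m - 7) p) := by
      rw [hP]
      ring
    simp only [h]
    rw [integral_const_mul, AIIITwo.blowupPolytope_eq hm]
    exact mul_neg_of_pos_of_neg hK (AIIITwo.integral_mul_polyDensity_neg _ (by linarith) hn)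
  simp only [sub_mul, add_mul] at hneg
  rw [integral_sub (hint (by fun_prop)) (hint (by fun_prop)),
    integral_add (hint (by fun_prop)) (hint (by fun_prop)), integral_sub
    (hint (by fun_prop)) (hint (by fun_prop)), integral_const_mul, integral_const_mul] at hneg
  simp only [AIIITwo.dhBarycenter]
  rw [← add_div, div_lt_iff₀ hV]
  unfold AIIITwo.dhVolume
  linarith
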